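/- Let $1\le n$, let $\mathbf{H}=[\mathbf{h}_1,\dots,\mathbf{h}_n]\in\mathbb{R}^{m\times n}$ have linearly independent columns, and let $\mathbf{R}$ be the triangular factor of its QR decomposition. The zero-forcing (ZF) estimator maps $\mathbf{y}\in\mathbb{R}^m$ to $\mathbf{x}^{\mathrm{zf}}=\lfloor(\mathbf{H}^\top\mathbf{H})^{-1}\mathbf{H}^\top\mathbf{y}\rceil\in\mathbb{Z}^n$ (entrywise rounding). Its energy efficiency for the basis $\mathbf{H}$ is the smallest $\eta$ such that $\|\mathbf{y}-\mathbf{H}\mathbf{x}^{\mathrm{zf}}\|\le\eta\min_{\mathbf{x}\in\mathbb{Z}^n}\|\mathbf{y}-\mathbf{H}\mathbf{x}\|$ for all $\mathbf{y}\in\mathbb{R}^m$. (i) Let $\delta\in(1/4,1)$ and $\beta=1/\sqrt{\delta-1/4}$. Suppose that $\mathbf{H}$ is boosted LLL (b-LLL) reduced with Lovász constant $\delta$ and some list size $p$, i.e. $\delta R_{i,i}^2\le(R_{i,i+1}-\lfloor R_{i,i+1}/R_{i,i}\rceil R_{i,i})^2+R_{i+1,i+1}^2$ for $1\le i\le n-1$,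 and for $2\le i\le n$ the vector $\mathbf{h}_i$ cannot be shortened by subtracting any of the $p$ candidates returned by an approximate closest vector oracle for the target $\mathbf{h}_i$ and the lattice generated by $\mathbf{h}_1,\dots,\mathbf{h}_{i-1}$; the list of candidates is a list of $p$ vectors of that lattice which contains a nearest plane (successive rounding) point. Then the energy efficiency of ZF exists and is at most $$\eta_n=2n\prod_{j=1}^n\beta^{j-1}+1 .$$ (ii) Suppose that $\mathbf{H}$ is boosted KZ (b-KZ) reduced, i.e. for $1\le i\le n$ the component of $\mathbf{h}_i$ orthogonal to $\mathrm{span}(\mathbf{h}_1,\dots,\mathbf{h}_{i-1})$ is a shortest nonzero vector of the lattice generated by the components of $\mathbf{h}_i,\dots,\mathbf{h}_n$ orthogonal to that span, and for $2\le i\le n$ one has $\|\mathbf{h}_i\|\le\|\mathbf{h}_i-\mathbf{q}_i\|$, where $\mathbf{q}_i$ is a point of the lattice generated by $\mathbf{h}_1,\dots,\mathbf{h}_{i-1}$ closest to the projection of $\mathbf{h}_i$ onto $\mathrm{span}(\mathbf{h}_1,\dots,\mathbf{h}_{i-1})$. Then the energy efficiency of ZF exists and is at most $$\eta_n=2n\prod_{j=1}^n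 j^{2+\ln(j)/2}+1 .$$ -/

import Mathlib

open scoped Matrix

noncomputable section

namespace LatticePrecoding

variable {m n : ℕ}

/-- The `i`-th column `h_i` of `H`, as a vector of Euclidean space. -/
def colVec (H : Matrix (Fin m) (Fin n) ℝ) (i : Fin n) : EuclideanSpace ℝ (Fin m) :=
  WithLp.toLp 2 (fun k => H k i)

/-- The vector `H x` for an integer vector `x`. -/
def latticePoint (H : Matrix (Fin m) (Fin n) ℝ) (x : Fin n → ℤ) : EuclideanSpace ℝ (Fin m) :=
  WithLp.toLp 2 (H *ᵥ fun i => (x i : ℝ))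

/-- The columns of `H` form a basis of the lattice they generate (they are linearly independent
over `ℝ`). -/
def IsBasis (H : Matrix (Fin m) (Fin n) ℝ) : Prop :=
  LinearIndependent ℝ (colVec H)

/-- The entry `R_{i,j}` of the triangular factor in the QR decomposition `H = Q R`, where the
columns of `Q` are the normalized Gram-Schmidt vectors of the columns of `H`. -/
def rEntry (H : Matrix (Fin m) (Fin n) ℝ) (i j : Fin n) : ℝ :=
  inner ℝ (InnerProductSpace.gramSchmidtNormed ℝ (colVec H) i) (colVec H j)

/-- The real span of the columns preceding `h_i`. -/
def prefixSpan (H : Matrix (Fin m) (Fin n) ℝ) (i : Fin n) :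
    Submodule ℝ (EuclideanSpace ℝ (Fin m)) :=
  Submodule.span ℝ (colVec H '' Set.Iio i)

/-- The lattice generated by the columns preceding `h_i`. -/
def prefixLattice (H : Matrix (Fin m) (Fin n) ℝ) (i : Fin n) :
    Submodule ℤ (EuclideanSpace ℝ (Fin m)) :=
  Submodule.span ℤ (colVec H '' Set.Iio i)

/-- The lattice generated by `h_i` and the columns following it. -/
def suffixLattice (H : Matrix (Fin m) (Fin n) ℝ) (i : Fin n) :
    Submodule ℤ (EuclideanSpace ℝ (Fin m)) :=
  Submodule.span ℤ (colVec H '' Set.Ici i)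

/-- Orthogonal projection onto the span of the columns preceding `h_i`. -/
def proj (H : Matrix (Fin m) (Fin n) ℝ) (i : Fin n) (v : EuclideanSpace ℝ (Fin m)) :
    EuclideanSpace ℝ (Fin m) :=
  (prefixSpan H i).starProjection v

/-- Orthogonal projection onto the orthogonal complement of the span of the columns preceding
`h_i`. -/
def projPerp (H : Matrix (Fin m) (Fin n) ℝ) (i : Fin n) (v : EuclideanSpace ℝ (Fin m)) :
    EuclideanSpace ℝ (Fin m) :=
  (prefixSpan H i)ᗮ.starProjection v

/-- `z` is an output of successive rounding (the nearest plane method) for the target `h_i` and the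
lattice generated by the preceding columns: `z` is supported on the indices before `i`, and from
the last layer to the first, `z_j` is a nearest integer to
`(R_{j,i} - ∑_{l > j} R_{j,l} z_l) / R_{j,j}`. -/
def IsNearestPlane (H : Matrix (Fin m) (Fin n) ℝ) (i : Fin n) (z : Fin n → ℤ) : Prop :=
  (∀ j, i ≤ j → z j = 0) ∧
    ∀ j, j < i →
      |(rEntry H j i - ∑ l ∈ Finset.Ioi j, rEntry H j l * (z l : ℝ)) / rEntry H j j - (z j : ℝ)|
        ≤ 1 / 2

/-- `S` is a candidate list of size `p` of an approximate closest vector oracle for the target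
`h_i` and the lattice generated by the preceding columns. Candidates are given by their integer
coefficients. The list contains a nearest plane point, so that for `p = 1` the oracle is the nearest
plane method and otherwise it is at least as good; the other candidates are arbitrary. -/
def IsOracleList (H : Matrix (Fin m) (Fin n) ℝ) (i : Fin n) (p : ℕ)
    (S : Finset (Fin n → ℤ)) : Prop :=
  S.card = p ∧ (∀ z ∈ S, ∀ j, i ≤ j → z j = 0) ∧ ∃ z ∈ S, IsNearestPlane H i z

/-- Boosted LLL reduced bases with Lovász constant `δ` and list size `p`: the diagonal reduction
conditions hold, and every `h_i` but the first is reduced by the list oracle with rejection, that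
is, every candidate of the oracle is rejected because subtracting it does not make `h_i`
shorter. -/
structure IsBoostedLLL (δ : ℝ) (p : ℕ) (H : Matrix (Fin m) (Fin n) ℝ) : Prop where
  basis : IsBasis H
  diagonal : ∀ i j : Fin n, (i : ℕ) + 1 = (j : ℕ) →
    δ * rEntry H i i ^ 2 ≤
      (rEntry H i j - (round (rEntry H i j / rEntry H i i) : ℝ) * rEntry H i i) ^ 2
        + rEntry H j j ^ 2
  length : ∀ i : Fin n, 0 < (i : ℕ) → ∃ S : Finset (Fin n → ℤ), IsOracleList H i p S ∧
    ∀ z ∈ S, ‖colVec H i‖ ≤ ‖colVec H i - latticePoint H z‖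

/-- `q` is a closest point to `v` in the lattice generated by the columns preceding `h_i`. -/
def IsNearestInPrefix (H : Matrix (Fin m) (Fin n) ℝ) (i : Fin n)
    (v q : EuclideanSpace ℝ (Fin m)) : Prop :=
  q ∈ prefixLattice H i ∧ ∀ q' ∈ prefixLattice H i, ‖v - q‖ ≤ ‖v - q'‖

/-- Boosted KZ reduced bases: the projection of `h_i` orthogonal to the preceding columns is a
shortest nonzero vector of the lattice generated by the projections of `h_i, …, h_n`, and `h_i`
does not become shorter by subtracting the quantization of its projection onto the span of
`h_1, …, h_{i-1}` in the lattice generated by these vectors. (In the second condition the choice of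
a closest lattice point `q` is irrelevant: `h_i - proj h_i` is orthogonal to that span, so all
choices give the same norm of `h_i - q`.) -/
structure IsBoostedKZ (H : Matrix (Fin m) (Fin n) ℝ) : Prop where
  basis : IsBasis H
  projection : ∀ i : Fin n, ∀ v ∈ suffixLattice H i, projPerp H i v ≠ 0 →
    ‖projPerp H i (colVec H i)‖ ≤ ‖projPerp H i v‖
  length : ∀ i : Fin n, 0 < (i : ℕ) → ∃ q, IsNearestInPrefix H i (proj H i (colVec H i)) q ∧
    ‖colVec H i‖ ≤ ‖colVec H i - q‖

/-- `x` is a solution of the closest vector problem: it minimizes `‖y - H x‖` over integer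
vectors. -/
def IsCVPSolution (H : Matrix (Fin m) (Fin n) ℝ) (y : EuclideanSpace ℝ (Fin m))
    (x : Fin n → ℤ) : Prop :=
  ∀ z : Fin n → ℤ, ‖y - latticePoint H x‖ ≤ ‖y - latticePoint H z‖

/-- The estimator `est` solves `η`-CVP for the basis `H`: for every target `y` a closest lattice
point `H x^cvp` exists and `‖y - H (est y)‖ ≤ η ‖y - H x^cvp‖`. -/
def SolvesCVP (H : Matrix (Fin m) (Fin n) ℝ)
    (est : EuclideanSpace ℝ (Fin m) → Fin n → ℤ) (η : ℝ) : Prop :=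
  ∀ y, ∃ xcvp, IsCVPSolution H y xcvp ∧
    ‖y - latticePoint H (est y)‖ ≤ η * ‖y - latticePoint H xcvp‖

/-- `η` is the energy efficiency of the estimator `est` for the basis `H`: the smallest number such
that `est` solves `η`-CVP. -/
def IsEnergyEfficiency (H : Matrix (Fin m) (Fin n) ℝ)
    (est : EuclideanSpace ℝ (Fin m) → Fin n → ℤ) (η : ℝ) : Prop :=
  IsLeast {t : ℝ | SolvesCVP H est t} η

/-- The pseudo-inverse `(Hᵀ H)⁻¹ Hᵀ` of a matrix with linearly independent columns. -/
def pinv (H : Matrix (Fin m) (Fin n) ℝ) : Matrix (Fin n) (Fin m) ℝ :=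
  (Hᵀ * H)⁻¹ * Hᵀ

/-- The zero-forcing estimate: the entrywise rounding of `H† y`. -/
def zf (H : Matrix (Fin m) (Fin n) ℝ) (y : EuclideanSpace ℝ (Fin m)) : Fin n → ℤ :=
  fun i => round ((pinv H *ᵥ y.ofLp) i)

end LatticePrecoding

end

noncomputable section

namespace LatticePrecoding

variable {m n : ℕ}

/-! Let `w` be the residual `y - H x` of a closest lattice point `H x`. Rounding commutes with
integer shifts, so the ZF residual is `w - ∑ round(c_i) h_i` with `c = H† w`. Since `|round a| ≤
2|a|`, everything rests on `|c_i| ‖h_i‖ ≤ D ‖w‖`, where `D = ∏ ‖h_j‖ / R_jj` is the orthogonality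
defect: this is Cramer's rule for `R c = Qᵀ w` with Hadamard's inequality
(`abs_pinv_mul_norm_colVec_le`). Hence ZF solves CVP with factor `2nD + 1` (`norm_sub_zf_le`).

It remains to bound each `‖h_i‖ / R_ii`. Both reductions make `h_i` no longer than its nearest plane
remainder, so `‖h_i‖² ≤ R_ii² + (1/4) ∑_{j<i} R_jj²`. For b-LLL the Lovász condition gives `R_ii² ≤
β² R_{i+1,i+1}²`, and the sum is geometric. For b-KZ, Minkowski's theorem on diagonal blocks of `R`
bounds `log R_kk²` by a mean of later ones plus a logarithm, and Schnorr's recursion solves this. -/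

/-- The `i`-th column of the orthogonal factor of the QR decomposition of `H`. -/
abbrev qVec (H : Matrix (Fin m) (Fin n) ℝ) (i : Fin n) : EuclideanSpace ℝ (Fin m) :=
  InnerProductSpace.gramSchmidtNormed ℝ (colVec H) i

/-- The triangular factor of the QR decomposition of `H`. -/
def rMat (H : Matrix (Fin m) (Fin n) ℝ) : Matrix (Fin n) (Fin n) ℝ :=
  Matrix.of (rEntry H)

/-! ### QR decomposition and the pseudo-inverse. -/

lemma qVec_orthonormal {H : Matrix (Fin m) (Fin n) ℝ} (hH : IsBasis H) :
    Orthonormal ℝ (qVec H) :=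
  InnerProductSpace.gramSchmidtNormed_orthonormal hH

lemma rEntry_eq_zero (H : Matrix (Fin m) (Fin n) ℝ) {i j : Fin n} (h : j < i) :
    rEntry H i j = 0 := by
  simp [rEntry, InnerProductSpace.gramSchmidtNormed, inner_smul_left,
    InnerProductSpace.gramSchmidt_inv_triangular ℝ (colVec H) h]

lemma rEntry_self_pos {H : Matrix (Fin m) (Fin n) ℝ} (hH : IsBasis H) (i : Fin n) :
    0 < rEntry H i i := by
  have h0 : 0 < ‖InnerProductSpace.gramSchmidt ℝ (colVec H) i‖ :=
    norm_pos_iff.2 (InnerProductSpace.gramSchmidt_ne_zero i hH)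
  have h1 : inner ℝ (InnerProductSpace.gramSchmidt ℝ (colVec H) i) (colVec H i)
      = ‖InnerProductSpace.gramSchmidt ℝ (colVec H) i‖ ^ 2 := by
    conv_lhs => rw [InnerProductSpace.gramSchmidt_def'' ℝ (colVec H) i]
    rw [inner_add_right, inner_sum, Finset.sum_eq_zero, real_inner_self_eq_norm_sq, add_zero]
    intro j hj
    rw [inner_smul_right, InnerProductSpace.gramSchmidt_orthogonal ℝ (colVec H)
      (Finset.mem_Iio.1 hj).ne', mul_zero]
  have h2 : rEntry H i i = ‖InnerProductSpace.gramSchmidt ℝ (colVec H) i‖⁻¹ *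
      ‖InnerProductSpace.gramSchmidt ℝ (colVec H) i‖ ^ 2 := by
    rw [← h1]
    simp [rEntry, InnerProductSpace.gramSchmidtNormed, inner_smul_left]
  rw [h2]
  positivity

lemma span_range_qVec (H : Matrix (Fin m) (Fin n) ℝ) :
    Submodule.span ℝ (Set.range (qVec H)) = Submodule.span ℝ (Set.range (colVec H)) :=
  (InnerProductSpace.span_gramSchmidtNormed_range _).trans
    (InnerProductSpace.span_gramSchmidt ℝ _)

lemma prefixSpan_eq_span_qVec (H : Matrix (Fin m) (Fin n) ℝ) (i : Fin n) :
    prefixSpan H i = Submodule.span ℝ (qVec H '' Set.Iio i) :=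
  ((InnerProductSpace.span_gramSchmidtNormed _ _).trans
    (InnerProductSpace.span_gramSchmidt_Iio ℝ _ i)).symm

lemma colVec_mem_span (H : Matrix (Fin m) (Fin n) ℝ) (j : Fin n) :
    colVec H j ∈ Submodule.span ℝ (Set.range (qVec H)) := by
  rw [span_range_qVec]
  exact Submodule.subset_span ⟨j, rfl⟩

lemma latticePoint_eq_sum (H : Matrix (Fin m) (Fin n) ℝ) (x : Fin n → ℤ) :
    latticePoint H x = ∑ j, (x j : ℝ) • colVec H j := by
  ext k
  simp [latticePoint, colVec, Matrix.mulVec, dotProduct, mul_comm]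

lemma latticePoint_sub (H : Matrix (Fin m) (Fin n) ℝ) (x z : Fin n → ℤ) :
    latticePoint H (x - z) = latticePoint H x - latticePoint H z := by
  simp [latticePoint_eq_sum, sub_smul]

lemma latticePoint_mem_span (H : Matrix (Fin m) (Fin n) ℝ) (x : Fin n → ℤ) :
    latticePoint H x ∈ Submodule.span ℝ (Set.range (qVec H)) := by
  rw [latticePoint_eq_sum]
  exact Submodule.sum_mem _ fun j _ => Submodule.smul_mem _ _ (colVec_mem_span H j)

lemma inner_qVec_latticePoint (H : Matrix (Fin m) (Fin n) ℝ) (x : Fin n → ℤ) (i : Fin n) :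
    inner ℝ (qVec H i) (latticePoint H x) = ∑ j, rEntry H i j * (x j : ℝ) := by
  rw [latticePoint_eq_sum, inner_sum]
  refine Finset.sum_congr rfl fun j _ => ?_
  rw [inner_smul_right, mul_comm]
  rfl

lemma eq_sum_of_mem_span_orthonormal {E ι : Type*} [NormedAddCommGroup E] [InnerProductSpace ℝ E]
    [Fintype ι] {e : ι → E} (he : Orthonormal ℝ e) {v : E}
    (hv : v ∈ Submodule.span ℝ (Set.range e)) : v = ∑ i, inner ℝ (e i) v • e i := by
  classical
  induction hv using Submodule.span_induction with
  | mem x hx =>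
    obtain ⟨k, rfl⟩ := hx
    simp [orthonormal_iff_ite.1 he]
  | zero => simp
  | add x y _ _ hx hy =>
    simp only [inner_add_right, add_smul, Finset.sum_add_distrib]
    rw [← hx, ← hy]
  | smul a x _ hx =>
    simp only [inner_smul_right, mul_smul]
    rw [← Finset.smul_sum, ← hx]

lemma norm_sq_sum_orthonormal {E ι : Type*} [NormedAddCommGroup E] [InnerProductSpace ℝ E]
    {e : ι → E} (he : Orthonormal ℝ e) (s : Finset ι) (a : ι → ℝ) :
    ‖∑ i ∈ s, a i • e i‖ ^ 2 = ∑ i ∈ s, a i ^ 2 := by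
  rw [← real_inner_self_eq_norm_sq, he.inner_sum]
  simp [sq]

lemma norm_sq_of_mem_span_qVec {H : Matrix (Fin m) (Fin n) ℝ} (hH : IsBasis H)
    {v : EuclideanSpace ℝ (Fin m)} (hv : v ∈ Submodule.span ℝ (Set.range (qVec H))) :
    ‖v‖ ^ 2 = ∑ i, inner ℝ (qVec H i) v ^ 2 := by
  conv_lhs => rw [eq_sum_of_mem_span_orthonormal (qVec_orthonormal hH) hv]
  exact norm_sq_sum_orthonormal (qVec_orthonormal hH) _ _

lemma norm_sq_colVec {H : Matrix (Fin m) (Fin n) ℝ} (hH : IsBasis H) (j : Fin n) :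
    ‖colVec H j‖ ^ 2 = ∑ i, rEntry H i j ^ 2 :=
  norm_sq_of_mem_span_qVec hH (colVec_mem_span H j)

lemma det_rMat (H : Matrix (Fin m) (Fin n) ℝ) : (rMat H).det = ∏ i, rEntry H i i :=
  Matrix.det_of_isUpperTriangular fun _ _ h => rEntry_eq_zero H h

/-- The orthogonal factor of the QR decomposition of `H`. -/
def qMat (H : Matrix (Fin m) (Fin n) ℝ) : Matrix (Fin m) (Fin n) ℝ :=
  Matrix.of fun k i => qVec H i k

lemma qMat_mul_rMat {H : Matrix (Fin m) (Fin n) ℝ} (hH : IsBasis H) : qMat H * rMat H = H := by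
  ext k j
  have h := congrArg (fun v : EuclideanSpace ℝ (Fin m) => v k)
    (eq_sum_of_mem_span_orthonormal (qVec_orthonormal hH) (colVec_mem_span H j))
  simp only [colVec, WithLp.ofLp_sum, Finset.sum_apply, PiLp.smul_apply, smul_eq_mul] at h
  rw [Matrix.mul_apply, h]
  exact Finset.sum_congr rfl fun i _ => mul_comm _ _

lemma transpose_qMat_mulVec (H : Matrix (Fin m) (Fin n) ℝ) (w : EuclideanSpace ℝ (Fin m)) :
    (qMat H)ᵀ *ᵥ w.ofLp = fun i => inner ℝ (qVec H i) w := by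
  ext i
  simp [qMat, Matrix.mulVec, dotProduct, PiLp.inner_apply, mul_comm]

lemma transpose_qMat_mul_qMat {H : Matrix (Fin m) (Fin n) ℝ} (hH : IsBasis H) :
    (qMat H)ᵀ * qMat H = 1 := by
  ext i j
  have h := congrFun (transpose_qMat_mulVec H (qVec H j)) i
  rw [orthonormal_iff_ite.1 (qVec_orthonormal hH)] at h
  rw [Matrix.one_apply, ← h]
  rfl

lemma isUnit_det_rMat {H : Matrix (Fin m) (Fin n) ℝ} (hH : IsBasis H) : IsUnit (rMat H).det := by
  rw [det_rMat, isUnit_iff_ne_zero]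
  exact Finset.prod_ne_zero_iff.2 fun i _ => (rEntry_self_pos hH i).ne'

lemma pinv_eq {H : Matrix (Fin m) (Fin n) ℝ} (hH : IsBasis H) :
    pinv H = (rMat H)⁻¹ * (qMat H)ᵀ := by
  have h1 : Hᵀ = (rMat H)ᵀ * (qMat H)ᵀ := by
    rw [← Matrix.transpose_mul, qMat_mul_rMat hH]
  have h2 : Hᵀ * H = (rMat H)ᵀ * rMat H := by
    rw [h1]
    nth_rewrite 3 [← qMat_mul_rMat hH]
    rw [Matrix.mul_assoc, ← Matrix.mul_assoc _ (qMat H), transpose_qMat_mul_qMat hH,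
      Matrix.one_mul]
  have h3 : IsUnit ((rMat H)ᵀ).det := by
    rw [Matrix.det_transpose]
    exact isUnit_det_rMat hH
  rw [pinv, h2, h1, Matrix.mul_inv_rev, Matrix.mul_assoc, ← Matrix.mul_assoc _ (rMat H)ᵀ,
    Matrix.nonsing_inv_mul _ h3, Matrix.one_mul]

lemma rMat_mulVec_pinv {H : Matrix (Fin m) (Fin n) ℝ} (hH : IsBasis H)
    (w : EuclideanSpace ℝ (Fin m)) :
    rMat H *ᵥ (pinv H *ᵥ w.ofLp) = fun i => inner ℝ (qVec H i) w := by
  rw [← transpose_qMat_mulVec, pinv_eq hH, Matrix.mulVec_mulVec, ← Matrix.mul_assoc,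
    Matrix.mul_nonsing_inv _ (isUnit_det_rMat hH), Matrix.one_mul]

lemma pinv_mul {H : Matrix (Fin m) (Fin n) ℝ} (hH : IsBasis H) : pinv H * H = 1 := by
  nth_rewrite 2 [← qMat_mul_rMat hH]
  rw [pinv_eq hH, Matrix.mul_assoc, ← Matrix.mul_assoc _ (qMat H), transpose_qMat_mul_qMat hH,
    Matrix.one_mul, Matrix.nonsing_inv_mul _ (isUnit_det_rMat hH)]

lemma pinv_mulVec_sub_latticePoint {H : Matrix (Fin m) (Fin n) ℝ} (hH : IsBasis H)
    (y : EuclideanSpace ℝ (Fin m)) (x : Fin n → ℤ) (i : Fin n) :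
    (pinv H *ᵥ (y - latticePoint H x).ofLp) i = (pinv H *ᵥ y.ofLp) i - x i := by
  rw [WithLp.ofLp_sub, Matrix.mulVec_sub, latticePoint, Matrix.mulVec_mulVec, pinv_mul hH,
    Matrix.one_mulVec, Pi.sub_apply]

/-! ### The ZF error is controlled by the orthogonality defect. -/

/-- Hadamard's inequality for the columns of a square matrix. -/
lemma abs_det_le_prod_norm_col (A : Matrix (Fin n) (Fin n) ℝ) :
    |A.det| ≤ ∏ j, ‖(WithLp.toLp 2 (A.col j) : EuclideanSpace ℝ (Fin n))‖ := by
  let b := EuclideanSpace.basisFun (Fin n) ℝ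
  have : Fact (Module.finrank ℝ (EuclideanSpace ℝ (Fin n)) = n) := ⟨by simp⟩
  let o : Orientation ℝ (EuclideanSpace ℝ (Fin n)) (Fin n) := b.toBasis.orientation
  have h := o.abs_volumeForm_apply_le fun j => WithLp.toLp 2 (A.col j)
  rw [o.volumeForm_robust' b, Module.Basis.det_apply] at h
  convert h using 3
  ext i j
  simp [b, Module.Basis.toMatrix_apply]

/-- Cramer's rule writes `c i * det R` as the determinant of `R` with column `i` replaced by `Qᵀ w`.
Hadamard bounds it by `‖w‖` times the norms of the other columns; the factor `‖h_i‖` completes the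
product, so the bound is the same for all `i`. -/
lemma abs_pinv_mul_norm_colVec_le {H : Matrix (Fin m) (Fin n) ℝ} (hH : IsBasis H)
    (w : EuclideanSpace ℝ (Fin m)) (i : Fin n) :
    |(pinv H *ᵥ w.ofLp) i| * ‖colVec H i‖ ≤ (∏ j, ‖colVec H j‖ / rEntry H j j) * ‖w‖ := by
  set c := pinv H *ᵥ w.ofLp with hc
  set t : Fin n → ℝ := fun i => inner ℝ (qVec H i) w with ht
  have hRc : rMat H *ᵥ c = t := rMat_mulVec_pinv hH w
  have hpos : 0 < ∏ j, rEntry H j j := Finset.prod_pos fun j _ => rEntry_self_pos hH j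
  have hdet : ((rMat H).updateCol i t).det = (∏ j, rEntry H j j) * c i := by
    rw [← Matrix.cramer_apply, ← hRc, Matrix.cramer_eq_adjugate_mulVec, Matrix.mulVec_mulVec,
      Matrix.adjugate_mul, Matrix.smul_mulVec, Matrix.one_mulVec, det_rMat]
    rfl
  have hcol : ∀ j, ‖(WithLp.toLp 2 ((rMat H).col j) : EuclideanSpace ℝ (Fin n))‖
      = ‖colVec H j‖ := by
    intro j
    rw [← sq_eq_sq₀ (norm_nonneg _) (norm_nonneg _), norm_sq_colVec hH,
      EuclideanSpace.real_norm_sq_eq]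
    rfl
  have htw : ‖(WithLp.toLp 2 t : EuclideanSpace ℝ (Fin n))‖ ≤ ‖w‖ := by
    rw [← sq_le_sq₀ (norm_nonneg _) (norm_nonneg _), EuclideanSpace.real_norm_sq_eq]
    have := (qVec_orthonormal hH).sum_inner_products_le (x := w) (s := Finset.univ)
    simpa [ht] using this
  have hle := abs_det_le_prod_norm_col ((rMat H).updateCol i t)
  rw [hdet, abs_mul, abs_of_pos hpos, ← Finset.mul_prod_erase _
    (fun j => ‖(WithLp.toLp 2 (((rMat H).updateCol i t).col j) : EuclideanSpace ℝ (Fin n))‖)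
    (Finset.mem_univ i)] at hle
  have h1 : ∀ j ∈ Finset.univ.erase i,
      ‖(WithLp.toLp 2 (((rMat H).updateCol i t).col j) : EuclideanSpace ℝ (Fin n))‖
        = ‖colVec H j‖ := by
    intro j hj
    rw [← hcol]
    congr 2
    ext k
    simp [Matrix.col_apply, Matrix.updateCol_ne (Finset.ne_of_mem_erase hj)]
  have h2 : ((rMat H).updateCol i t).col i = t := by
    ext k
    simp [Matrix.col_apply]
  rw [Finset.prod_congr rfl h1, h2] at hle
  rw [Finset.prod_div_distrib, div_mul_eq_mul_div, le_div_iff₀ hpos,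
    ← Finset.mul_prod_erase _ (fun j => ‖colVec H j‖) (Finset.mem_univ i)]
  have h3 : 0 ≤ ∏ j ∈ Finset.univ.erase i, ‖colVec H j‖ :=
    Finset.prod_nonneg fun j _ => norm_nonneg _
  calc |c i| * ‖colVec H i‖ * ∏ j, rEntry H j j
      = ((∏ j, rEntry H j j) * |c i|) * ‖colVec H i‖ := by ring
    _ ≤ (‖(WithLp.toLp 2 t : EuclideanSpace ℝ (Fin n))‖
          * ∏ j ∈ Finset.univ.erase i, ‖colVec H j‖) * ‖colVec H i‖ :=
        mul_le_mul_of_nonneg_right hle (norm_nonneg _)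
    _ ≤ (‖w‖ * ∏ j ∈ Finset.univ.erase i, ‖colVec H j‖) * ‖colVec H i‖ :=
        mul_le_mul_of_nonneg_right (mul_le_mul_of_nonneg_right htw h3) (norm_nonneg _)
    _ = _ := by ring

/-- A nonzero rounding has absolute value at least `1`, hence at least twice the rounding error.
Having no additive constant is what makes the ZF error proportional to `‖w‖`. -/
lemma abs_round_le (a : ℝ) : |(round a : ℝ)| ≤ 2 * |a| := by
  have h := abs_sub_round a
  by_cases h0 : round a = 0
  · rw [h0]
    simp
  · have h1 : (1 : ℝ) ≤ |(round a : ℝ)| := by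
      exact_mod_cast Int.one_le_abs h0
    have h2 : |(round a : ℝ)| ≤ |a| + |a - round a| := by
      have := abs_sub a (a - round a)
      rwa [sub_sub_cancel] at this
    linarith

/-- The orthogonality defect of the columns of `H`. -/
def defect (H : Matrix (Fin m) (Fin n) ℝ) : ℝ := ∏ j, ‖colVec H j‖ / rEntry H j j

lemma norm_sub_zf_le {H : Matrix (Fin m) (Fin n) ℝ} (hH : IsBasis H)
    (y : EuclideanSpace ℝ (Fin m)) (x : Fin n → ℤ) :
    ‖y - latticePoint H (zf H y)‖ ≤ (2 * n * defect H + 1) * ‖y - latticePoint H x‖ := by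
  set w := y - latticePoint H x with hw
  have hsplit : y - latticePoint H (zf H y) = w - latticePoint H (zf H y - x) := by
    rw [latticePoint_sub, hw]
    abel
  have hzf : ∀ i, (zf H y - x) i = round ((pinv H *ᵥ w.ofLp) i) := by
    intro i
    rw [hw, pinv_mulVec_sub_latticePoint hH, round_sub_intCast]
    rfl
  have hterm : ∀ i ∈ Finset.univ, ‖((zf H y - x) i : ℝ) • colVec H i‖
      ≤ 2 * (defect H * ‖w‖) := by
    intro i _
    rw [norm_smul, Real.norm_eq_abs, hzf]
    have h1 := abs_round_le ((pinv H *ᵥ w.ofLp) i)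
    have h2 := abs_pinv_mul_norm_colVec_le hH w i
    calc _ ≤ (2 * |(pinv H *ᵥ w.ofLp) i|) * ‖colVec H i‖ := by gcongr
      _ = 2 * (|(pinv H *ᵥ w.ofLp) i| * ‖colVec H i‖) := by ring
      _ ≤ _ := by unfold defect; gcongr
  have hsum : ‖latticePoint H (zf H y - x)‖ ≤ n * (2 * (defect H * ‖w‖)) := by
    rw [latticePoint_eq_sum]
    refine (norm_sum_le_of_le _ hterm).trans_eq ?_
    simp
  rw [hsplit]
  refine (norm_sub_le _ _).trans ?_
  linarith

/-! ### Closest points and existence of the energy efficiency. -/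

lemma norm_colVec_pos {H : Matrix (Fin m) (Fin n) ℝ} (hH : IsBasis H) (i : Fin n) :
    0 < ‖colVec H i‖ :=
  norm_pos_iff.2 (hH.ne_zero i)

lemma exists_isCVPSolution {H : Matrix (Fin m) (Fin n) ℝ} (hH : IsBasis H)
    (y : EuclideanSpace ℝ (Fin m)) : ∃ x, IsCVPSolution H y x := by
  set S : Set (Fin n → ℤ) := {x | ‖y - latticePoint H x‖ ≤ ‖y - latticePoint H 0‖} with hS
  have hfin : S.Finite := by
    -- Points no farther from `y` than the origin have bounded coefficients, by the estimate on `H†`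
    -- applied to `y - H x`; so the minimum runs over a finite set.
    let K : Fin n → ℤ := fun i =>
      ⌈|(pinv H *ᵥ y.ofLp) i| + defect H * ‖y - latticePoint H 0‖ / ‖colVec H i‖⌉
    refine (Set.finite_Icc (-K) K).subset fun x hx => ?_
    have hK : ∀ i, |x i| ≤ K i := by
      intro i
      have h1 := abs_pinv_mul_norm_colVec_le hH (y - latticePoint H x) i
      rw [pinv_mulVec_sub_latticePoint hH, ← le_div_iff₀ (norm_colVec_pos hH i)] at h1
      have hD : 0 ≤ defect H := Finset.prod_nonneg fun j _ =>
        div_nonneg (norm_nonneg _) (rEntry_self_pos hH j).le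
      have h2 : defect H * ‖y - latticePoint H x‖ / ‖colVec H i‖
          ≤ defect H * ‖y - latticePoint H 0‖ / ‖colVec H i‖ := by
        have : ‖y - latticePoint H x‖ ≤ ‖y - latticePoint H 0‖ := hx
        gcongr
      have h3 := abs_sub ((pinv H *ᵥ y.ofLp) i) ((pinv H *ᵥ y.ofLp) i - x i)
      rw [sub_sub_cancel] at h3
      have h4 : (|x i| : ℝ) ≤ (K i : ℝ) :=
        (h3.trans (add_le_add le_rfl (h1.trans h2))).trans (Int.le_ceil _)
      exact_mod_cast h4
    exact ⟨fun i => (abs_le.1 (hK i)).1, fun i => (abs_le.1 (hK i)).2⟩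
  obtain ⟨x, hxS, hx⟩ := Set.exists_min_image S (fun x => ‖y - latticePoint H x‖) hfin
    ⟨0, by simp [hS]⟩
  refine ⟨x, fun z => ?_⟩
  by_cases hz : z ∈ S
  · exact hx z hz
  · exact le_trans hxS (not_le.1 hz).le

/-- All closest points are at the same distance, so one fixed choice of them suffices. -/
lemma solvesCVP_iff {H : Matrix (Fin m) (Fin n) ℝ}
    {est xs : EuclideanSpace ℝ (Fin m) → Fin n → ℤ} (hxs : ∀ y, IsCVPSolution H y (xs y))
    (t : ℝ) : SolvesCVP H est t ↔
      ∀ y, ‖y - latticePoint H (est y)‖ ≤ t * ‖y - latticePoint H (xs y)‖ := by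
  constructor
  · intro h y
    obtain ⟨x, hx, hle⟩ := h y
    rwa [le_antisymm (hx (xs y)) (hxs y x)] at hle
  · exact fun h y => ⟨xs y, hxs y, h y⟩

/-- The admissible factors form an intersection of closed half-lines. A target off the lattice
forces them to be nonnegative, so the infimum is attained. -/
lemma exists_isEnergyEfficiency_le {H : Matrix (Fin m) (Fin n) ℝ} (hn : 1 ≤ n) (hH : IsBasis H)
    {est : EuclideanSpace ℝ (Fin m) → Fin n → ℤ} {t : ℝ} (ht : SolvesCVP H est t) :
    ∃ η, IsEnergyEfficiency H est η ∧ η ≤ t := by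
  choose xs hxs using exists_isCVPSolution hH
  have hclosed : IsClosed {t : ℝ | SolvesCVP H est t} := by
    simp only [solvesCVP_iff hxs, Set.ofPred_forall]
    exact isClosed_iInter fun y => isClosed_le continuous_const (by fun_prop)
  have hbdd : BddBelow {t : ℝ | SolvesCVP H est t} := by
    let i : Fin n := ⟨0, hn⟩
    -- Half a basis vector has a non-integer coefficient, so it is not a lattice point; `1 ≤ n`
    -- provides the vector.
    obtain ⟨y, hy⟩ : ∃ y : EuclideanSpace ℝ (Fin m),
        y = (2⁻¹ : ℝ) • latticePoint H (Pi.single i 1) := ⟨_, rfl⟩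
    have hpos : 0 < ‖y - latticePoint H (xs y)‖ := by
      rw [norm_pos_iff]
      intro h0
      have h1 := pinv_mulVec_sub_latticePoint hH y (xs y) i
      have h2 := pinv_mulVec_sub_latticePoint hH 0 (Pi.single i 1) i
      simp only [zero_sub, WithLp.ofLp_neg, Matrix.mulVec_neg, Pi.neg_apply, WithLp.ofLp_zero,
        Matrix.mulVec_zero, Pi.zero_apply, neg_inj, Pi.single_eq_same] at h2
      have h5 : (pinv H *ᵥ y.ofLp) i = 2⁻¹ * (1 : ℤ) := by
        rw [hy, WithLp.ofLp_smul, Matrix.mulVec_smul, Pi.smul_apply, h2, smul_eq_mul]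
      rw [h0, h5, WithLp.ofLp_zero, Matrix.mulVec_zero, Pi.zero_apply] at h1
      have h3 : (2 * xs y i : ℝ) = 1 := by
        push_cast at h1
        linarith
      have h4 : 2 * xs y i = 1 := by exact_mod_cast h3
      omega
    refine ⟨0, fun s hs => ?_⟩
    have := (solvesCVP_iff hxs s).1 hs y
    exact nonneg_of_mul_nonneg_left ((norm_nonneg _).trans this) hpos
  exact ⟨_, ⟨hclosed.csInf_mem ⟨t, ht⟩ hbdd, fun s hs => csInf_le hbdd hs⟩, csInf_le hbdd ht⟩

lemma exists_zf_isEnergyEfficiency_le {H : Matrix (Fin m) (Fin n) ℝ} (hn : 1 ≤ n)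
    (hH : IsBasis H) {f : ℕ → ℝ} (hf : ∀ i : Fin n, ‖colVec H i‖ ≤ f (i + 1) * rEntry H i i) :
    ∃ η, IsEnergyEfficiency H (zf H) η ∧ η ≤ 2 * n * (∏ j ∈ Finset.Icc 1 n, f j) + 1 := by
  choose xs hxs using exists_isCVPSolution hH
  obtain ⟨η, hη, hle⟩ := exists_isEnergyEfficiency_le hn hH (est := zf H)
    ((solvesCVP_iff hxs _).2 fun y => norm_sub_zf_le hH y (xs y))
  refine ⟨η, hη, hle.trans ?_⟩
  have h1 : ∏ j ∈ Finset.Icc 1 n, f j = ∏ i : Fin n, f (i + 1) := by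
    rw [Fin.prod_univ_eq_prod_range (fun i => f (i + 1)), Finset.range_eq_Ico,
      Finset.prod_Ico_add' f 0 n 1]
    rfl
  have h2 : defect H ≤ ∏ j ∈ Finset.Icc 1 n, f j := by
    rw [h1]
    exact Finset.prod_le_prod (fun j _ => div_nonneg (norm_nonneg _) (rEntry_self_pos hH j).le)
      fun j _ => (div_le_iff₀ (rEntry_self_pos hH j)).2 (hf j)
  gcongr

/-! ### Nearest plane points. -/

/-- The effect of subtracting a nearest plane point. -/
lemma norm_sq_sub_nearestPlane_le {H : Matrix (Fin m) (Fin n) ℝ} (hH : IsBasis H) {i : Fin n}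
    {z : Fin n → ℤ} (hz : IsNearestPlane H i z) :
    ‖colVec H i - latticePoint H z‖ ^ 2
      ≤ rEntry H i i ^ 2 + 1 / 4 * ∑ j ∈ Finset.Iio i, rEntry H j j ^ 2 := by
  have hcoord : ∀ j, inner ℝ (qVec H j) (colVec H i - latticePoint H z)
      = rEntry H j i - rEntry H j j * z j - ∑ l ∈ Finset.Ioi j, rEntry H j l * (z l : ℝ) := by
    intro j
    rw [inner_sub_right, inner_qVec_latticePoint, sub_sub]
    congr 1
    rw [← Finset.sum_subset (Finset.subset_univ (Finset.Ici j)),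
      ← Finset.Ioi_insert, Finset.sum_insert Finset.notMem_Ioi_self]
    intro l _ hl
    rw [rEntry_eq_zero H (not_le.1 fun h => hl (Finset.mem_Ici.2 h)), zero_mul]
  have htail : ∀ j, i ≤ j → ∑ l ∈ Finset.Ioi j, rEntry H j l * (z l : ℝ) = 0 := fun j hj =>
    Finset.sum_eq_zero fun l hl => by
      rw [hz.1 l (hj.trans (Finset.mem_Ioi.1 hl).le), Int.cast_zero, mul_zero]
  rw [norm_sq_of_mem_span_qVec hH
    (Submodule.sub_mem _ (colVec_mem_span H i) (latticePoint_mem_span H z))]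
  rw [← Finset.sum_subset (Finset.subset_univ (Finset.Iic i)), ← Finset.Iio_insert,
    Finset.sum_insert Finset.notMem_Iio_self]
  · refine add_le_add (le_of_eq ?_) ?_
    · rw [hcoord, htail i le_rfl, hz.1 i le_rfl]
      simp
    · rw [Finset.mul_sum]
      refine Finset.sum_le_sum fun j hj => ?_
      have hpos := rEntry_self_pos hH j
      have h := hz.2 j (Finset.mem_Iio.1 hj)
      rw [hcoord]
      -- Coordinate `j` of the remainder is `R_jj` times a rounding error of at most `1/2`.
      have heq : rEntry H j i - rEntry H j j * z j - ∑ l ∈ Finset.Ioi j, rEntry H j l * (z l : ℝ)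
          = rEntry H j j * ((rEntry H j i - ∑ l ∈ Finset.Ioi j, rEntry H j l * (z l : ℝ))
            / rEntry H j j - z j) := by
        field_simp
        ring
      rw [heq, mul_pow, ← sq_abs (_ / _ - _), mul_comm]
      gcongr
      calc _ ≤ (1 / 2 : ℝ) ^ 2 := by gcongr
        _ = 1 / 4 := by norm_num
  · intro j _ hj
    have hij : i < j := not_le.1 fun h => hj (Finset.mem_Iic.2 h)
    rw [hcoord, htail j hij.le, hz.1 j hij.le, rEntry_eq_zero H hij]
    simp

/-- Back substitution: the induction fixes the last `k` layers, and rounding at a new layer leaves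
the sums of the later layers unchanged. -/
lemma exists_isNearestPlane (H : Matrix (Fin m) (Fin n) ℝ) (i : Fin n) :
    ∃ z, IsNearestPlane H i z := by
  have key : ∀ k : ℕ, k ≤ n → ∃ z : Fin n → ℤ, (∀ j, i ≤ j → z j = 0) ∧ ∀ j : Fin n, n - k ≤ j →
      j < i → |(rEntry H j i - ∑ l ∈ Finset.Ioi j, rEntry H j l * (z l : ℝ)) / rEntry H j j
        - (z j : ℝ)| ≤ 1 / 2 := by
    intro k
    induction k with
    | zero =>
      intro _
      exact ⟨0, fun _ _ => rfl, fun j hj => absurd j.2 (by omega)⟩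
    | succ k ih =>
      intro hk
      obtain ⟨z, hz0, hz⟩ := ih (by omega)
      let p : Fin n := ⟨n - (k + 1), by omega⟩
      by_cases hp : p < i
      · refine ⟨Function.update z p (round ((rEntry H p i
          - ∑ l ∈ Finset.Ioi p, rEntry H p l * (z l : ℝ)) / rEntry H p p)), ?_, ?_⟩
        · intro j hj
          rw [Function.update_of_ne (hp.trans_le hj).ne', hz0 j hj]
        · intro j hj hji
          have hpj : p ≤ j := hj
          have hsum : ∀ u : ℤ, ∑ l ∈ Finset.Ioi j, rEntry H j l * (Function.update z p u l : ℝ)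
              = ∑ l ∈ Finset.Ioi j, rEntry H j l * (z l : ℝ) := fun u =>
            Finset.sum_congr rfl fun l hl => by
              rw [Function.update_of_ne (hpj.trans_lt (Finset.mem_Ioi.1 hl)).ne']
          rw [hsum]
          rcases hpj.eq_or_lt with rfl | hlt
          · rw [Function.update_self]
            exact abs_sub_round _
          · rw [Function.update_of_ne hlt.ne']
            refine hz j ?_ hji
            have : n - (k + 1) < (j : ℕ) := hlt
            omega
      · refine ⟨z, hz0, fun j hj hji => absurd ?_ hp⟩
        exact lt_of_le_of_lt (show p ≤ j from hj) hji
  obtain ⟨z, hz0, hz⟩ := key n le_rfl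
  exact ⟨z, hz0, fun j hj => hz j (by simp) hj⟩

lemma norm_colVec_zero {H : Matrix (Fin m) (Fin n) ℝ} (hH : IsBasis H) {i : Fin n}
    (hi : (i : ℕ) = 0) : ‖colVec H i‖ ^ 2 = rEntry H i i ^ 2 := by
  rw [norm_sq_colVec hH, Finset.sum_eq_single i]
  · intro j _ hj
    have : i < j := by
      rw [Fin.lt_def]
      have := Fin.val_ne_of_ne hj
      omega
    rw [rEntry_eq_zero H this, zero_pow two_ne_zero]
  · simp

lemma Iio_succ_eq_insert {i j : Fin n} (hij : (i : ℕ) + 1 = j) :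
    Finset.Iio j = insert i (Finset.Iio i) := by
  ext l
  simp only [Finset.mem_Iio, Finset.mem_insert, Fin.lt_def, Fin.ext_iff]
  omega

/-! ### Column lengths of b-LLL bases. -/

lemma IsBoostedLLL.norm_sq_colVec_le {δ : ℝ} {p : ℕ} {H : Matrix (Fin m) (Fin n) ℝ}
    (h : IsBoostedLLL δ p H) (i : Fin n) :
    ‖colVec H i‖ ^ 2 ≤ rEntry H i i ^ 2 + 1 / 4 * ∑ j ∈ Finset.Iio i, rEntry H j j ^ 2 := by
  rcases Nat.eq_zero_or_pos (i : ℕ) with hi | hi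
  · rw [norm_colVec_zero h.basis hi]
    have : 0 ≤ ∑ j ∈ Finset.Iio i, rEntry H j j ^ 2 := by positivity
    linarith
  · obtain ⟨S, ⟨_, _, z, hzS, hz⟩, hS⟩ := h.length i hi
    exact (pow_le_pow_left₀ (norm_nonneg _) (hS z hzS) 2).trans
      (norm_sq_sub_nearestPlane_le h.basis hz)

/-- The rounded remainder in the Lovász condition is at most `R_ii / 2` in absolute value, which
costs `1/4` of `δ`. -/
lemma IsBoostedLLL.sq_rEntry_le {δ : ℝ} {p : ℕ} {H : Matrix (Fin m) (Fin n) ℝ}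
    (hδ : 1 / 4 < δ) (h : IsBoostedLLL δ p H) {i j : Fin n} (hij : (i : ℕ) + 1 = j) :
    rEntry H i i ^ 2 ≤ 1 / (δ - 1 / 4) * rEntry H j j ^ 2 := by
  have h1 := h.diagonal i j hij
  have hpos := rEntry_self_pos h.basis i
  have h2 : (rEntry H i j - (round (rEntry H i j / rEntry H i i) : ℝ) * rEntry H i i) ^ 2
      ≤ 1 / 4 * rEntry H i i ^ 2 := by
    have heq : rEntry H i j - (round (rEntry H i j / rEntry H i i) : ℝ) * rEntry H i i
        = (rEntry H i j / rEntry H i i - round (rEntry H i j / rEntry H i i)) * rEntry H i i := by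
      field_simp
    rw [heq, mul_pow, ← sq_abs (_ - _)]
    gcongr
    calc _ ≤ (1 / 2 : ℝ) ^ 2 := by
          gcongr
          exact abs_sub_round _
      _ = 1 / 4 := by norm_num
  rw [one_div_mul_eq_div, le_div_iff₀ (by linarith)]
  linarith

lemma IsBoostedLLL.sum_sq_rEntry_le {δ : ℝ} {p : ℕ} {H : Matrix (Fin m) (Fin n) ℝ}
    (hδ : 1 / 4 < δ) (hδ1 : δ < 1) (h : IsBoostedLLL δ p H) (i : Fin n) :
    rEntry H i i ^ 2 + 1 / 4 * ∑ j ∈ Finset.Iio i, rEntry H j j ^ 2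
      ≤ (1 / (δ - 1 / 4)) ^ (i : ℕ) * rEntry H i i ^ 2 := by
  -- This is where `δ < 1` enters: `(3/4) B ≥ 1` lets the induction absorb the extra diagonal term.
  have hB : 4 / 3 ≤ 1 / (δ - 1 / 4) := by
    rw [le_div_iff₀ (by linarith)]
    linarith
  obtain ⟨i, hi⟩ := i
  induction i with
  | zero =>
    have : Finset.Iio (⟨0, hi⟩ : Fin n) = ∅ := by
      ext l
      simp [Fin.lt_def]
    simp [this]
  | succ k ih =>
    have hk : k < n := by omega
    have ih := ih hk
    have hle := h.sq_rEntry_le hδ (i := ⟨k, hk⟩) (j := ⟨k + 1, hi⟩) rfl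
    rw [Iio_succ_eq_insert (i := ⟨k, hk⟩) (j := ⟨k + 1, hi⟩) rfl,
      Finset.sum_insert Finset.notMem_Iio_self]
    dsimp only at ih ⊢
    set B := 1 / (δ - 1 / 4)
    set a := rEntry H ⟨k, hk⟩ ⟨k, hk⟩ ^ 2
    set c := rEntry H ⟨k + 1, hi⟩ ⟨k + 1, hi⟩ ^ 2
    have hc : 0 ≤ c := sq_nonneg _
    have hBk : 1 ≤ B ^ k := one_le_pow₀ (by linarith)
    calc c + 1 / 4 * (a + ∑ j ∈ Finset.Iio (⟨k, hk⟩ : Fin n), rEntry H j j ^ 2)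
        ≤ c + (B ^ k - 3 / 4) * a := by linarith
      _ ≤ c + (B ^ k - 3 / 4) * (B * c) := by
          gcongr
          linarith
      _ = B ^ (k + 1) * c - (3 / 4 * B - 1) * c := by ring
      _ ≤ B ^ (k + 1) * c := by
          have : 0 ≤ (3 / 4 * B - 1) * c := mul_nonneg (by linarith) hc
          linarith

lemma IsBoostedLLL.norm_colVec_le {δ β : ℝ} {p : ℕ} {H : Matrix (Fin m) (Fin n) ℝ}
    (hδ : 1 / 4 < δ) (hδ1 : δ < 1) (hβ : β = 1 / Real.sqrt (δ - 1 / 4))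
    (h : IsBoostedLLL δ p H) (i : Fin n) :
    ‖colVec H i‖ ≤ β ^ (i : ℕ) * rEntry H i i := by
  have hβ2 : β ^ 2 = 1 / (δ - 1 / 4) := by
    rw [hβ, div_pow, Real.sq_sqrt (by linarith), one_pow]
  have hβ0 : 0 ≤ β := by
    rw [hβ]
    positivity
  refine le_of_sq_le_sq ?_ (mul_nonneg (pow_nonneg hβ0 _) (rEntry_self_pos h.basis i).le)
  rw [mul_pow, ← pow_mul, mul_comm (i : ℕ), pow_mul, hβ2]
  exact (h.norm_sq_colVec_le i).trans (h.sum_sq_rEntry_le hδ hδ1 i)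

/-! ### Minkowski's theorem and the diagonal of b-KZ bases. -/

/-- Minkowski's theorem on linear forms. -/
lemma exists_int_abs_mulVec_le {ι : Type*} [Fintype ι] [DecidableEq ι] [Nonempty ι]
    {A : Matrix ι ι ℝ} (hA : A.det ≠ 0) {s : ℝ} (hs : 0 ≤ s)
    (h : |A.det| ≤ s ^ Fintype.card ι) :
    ∃ x : ι → ℤ, x ≠ 0 ∧ ∀ i, |(A *ᵥ fun j => (x j : ℝ)) i| ≤ s := by
  classical
  have hli : LinearIndependent ℝ (fun j => A.col j) :=
    Matrix.linearIndependent_cols_of_det_ne_zero hA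
  let b := basisOfPiSpaceOfLinearIndependent hli
  have hb : ∀ j, b j = A.col j := fun j => by
    simp [b]
  have hdet : |(Matrix.of b).det| = |A.det| := by
    rw [← Matrix.det_transpose A]
    congr 2
    ext i j
    simp [hb]
  have : DiscreteTopology (Submodule.span ℤ (Set.range b)).toAddSubgroup :=
    inferInstanceAs (DiscreteTopology (Submodule.span ℤ (Set.range b)))
  have : Countable (Submodule.span ℤ (Set.range b)).toAddSubgroup :=
    inferInstanceAs (Countable (Submodule.span ℤ (Set.range b)))
  -- The sup-norm ball of radius `s` is a cube of volume `(2s)^d`, where `d` is the dimension, and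
  -- the lattice has covolume `|det A|`; the hypothesis on `s` is Minkowski's condition. Compactness
  -- of the ball permits equality.
  obtain ⟨v, hv0, hv⟩ :=
    MeasureTheory.exists_ne_zero_mem_lattice_of_measure_mul_two_pow_le_measure
      (ZSpan.isAddFundamentalDomain' b MeasureTheory.volume) (s := Metric.closedBall 0 s)
      (fun x hx => by simpa using hx) (convex_closedBall 0 s) (isCompact_closedBall 0 s) (by
        rw [ZSpan.volume_fundamentalDomain, hdet, Real.volume_pi_closedBall _ hs, mul_pow,
          mul_comm, Module.finrank_fintype_fun_eq_card,
          ENNReal.ofReal_mul (by positivity), ENNReal.ofReal_pow (by norm_num),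
          ENNReal.ofReal_ofNat]
        gcongr)
  obtain ⟨x, hx⟩ := (Submodule.mem_span_range_iff_exists_fun ℤ).1 v.2
  have hAx : (A *ᵥ fun j => (x j : ℝ)) = (v : ι → ℝ) := by
    rw [← hx]
    ext i
    simp [Matrix.mulVec, dotProduct, hb, mul_comm]
  refine ⟨x, ?_, fun i => ?_⟩
  · rintro rfl
    apply hv0
    ext i
    simp [← hx]
  · rw [hAx, ← Real.norm_eq_abs]
    exact (norm_le_pi_norm _ i).trans (mem_closedBall_zero_iff.1 hv)

lemma norm_sq_projPerp {H : Matrix (Fin m) (Fin n) ℝ} (hH : IsBasis H) (k : Fin n)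
    {v : EuclideanSpace ℝ (Fin m)} (hv : v ∈ Submodule.span ℝ (Set.range (qVec H))) :
    ‖projPerp H k v‖ ^ 2 = ∑ i ∈ Finset.Ici k, inner ℝ (qVec H i) v ^ 2 := by
  have hq := qVec_orthonormal hH
  have hperp : projPerp H k v = ∑ i ∈ Finset.Ici k, inner ℝ (qVec H i) v • qVec H i := by
    refine Submodule.eq_starProjection_of_mem_orthogonal'
      (z := ∑ i ∈ Finset.Iio k, inner ℝ (qVec H i) v • qVec H i) ?_ ?_ ?_
    · refine Submodule.sum_mem _ fun i hi => Submodule.smul_mem _ _ ?_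
      rw [prefixSpan_eq_span_qVec, Submodule.mem_orthogonal]
      intro u hu
      induction hu using Submodule.span_induction with
      | mem u hu =>
        obtain ⟨l, hl, rfl⟩ := hu
        exact hq.2 ((Set.mem_Iio.1 hl).trans_le (Finset.mem_Ici.1 hi)).ne
      | zero => simp
      | add a b _ _ ha hb => rw [inner_add_left, ha, hb, add_zero]
      | smul c a _ ha => rw [inner_smul_left, ha, mul_zero]
    · refine Submodule.le_orthogonal_orthogonal _ ?_
      rw [prefixSpan_eq_span_qVec]
      exact Submodule.sum_mem _ fun i hi => Submodule.smul_mem _ _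
        (Submodule.subset_span ⟨i, Finset.mem_Iio.1 hi, rfl⟩)
    · conv_lhs => rw [eq_sum_of_mem_span_orthonormal hq hv]
      rw [← Finset.sum_union]
      · congr 1
        ext i
        simp [le_or_gt]
      · rw [Finset.disjoint_left]
        intro i hi hi'
        exact not_lt.2 (Finset.mem_Ici.1 hi) (Finset.mem_Iio.1 hi')
  rw [hperp, norm_sq_sum_orthonormal hq]

lemma IsBoostedKZ.sq_rEntry_le_sum {H : Matrix (Fin m) (Fin n) ℝ} (h : IsBoostedKZ H)
    {k : Fin n} {x : Fin n → ℤ} (hx : x ≠ 0) (hxk : ∀ l, l < k → x l = 0) :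
    rEntry H k k ^ 2 ≤ ∑ i ∈ Finset.Ici k, (∑ l, rEntry H i l * (x l : ℝ)) ^ 2 := by
  have hv := norm_sq_projPerp h.basis k (latticePoint_mem_span H x)
  have hk : ‖projPerp H k (colVec H k)‖ ^ 2 = rEntry H k k ^ 2 := by
    rw [norm_sq_projPerp h.basis k (colVec_mem_span H k), Finset.sum_eq_single k]
    · rfl
    · intro i hi hik
      change rEntry H i k ^ 2 = 0
      rw [rEntry_eq_zero H ((Finset.mem_Ici.1 hi).lt_of_ne hik.symm), zero_pow two_ne_zero]
    · simp
  simp only [inner_qVec_latticePoint] at hv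
  rw [← hv, ← hk]
  refine pow_le_pow_left₀ (norm_nonneg _) (h.projection k _ ?_ ?_) 2
  · rw [latticePoint_eq_sum]
    refine Submodule.sum_mem _ fun l _ => ?_
    by_cases hl : l < k
    · rw [hxk l hl]
      simp
    · rw [Int.cast_smul_eq_zsmul]
      exact Submodule.smul_mem _ _ (Submodule.subset_span ⟨l, not_lt.1 hl, rfl⟩)
  · intro h0
    obtain ⟨l₀, hl₀⟩ := Function.ne_iff.1 hx
    -- At the last nonzero coefficient `x_l`, triangularity leaves only `R_ll x_l`, so the
    -- projection cannot vanish.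
    obtain ⟨l, hl, hmax⟩ := Finset.exists_max_image (Finset.univ.filter fun l => x l ≠ 0) id
      ⟨l₀, by simpa using hl₀⟩
    have hxl : x l ≠ 0 := (Finset.mem_filter.1 hl).2
    have hkl : k ≤ l := not_lt.1 fun hlt => hxl (hxk l hlt)
    rw [h0, norm_zero, zero_pow two_ne_zero, eq_comm,
      Finset.sum_eq_zero_iff_of_nonneg fun _ _ => sq_nonneg _] at hv
    have hl0 := pow_eq_zero_iff two_ne_zero |>.1 (hv l (Finset.mem_Ici.2 hkl))
    rw [Finset.sum_eq_single l] at hl0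
    · exact mul_ne_zero (rEntry_self_pos h.basis l).ne' (Int.cast_ne_zero.2 hxl) hl0
    · intro j _ hj
      rcases hj.lt_or_gt with hlt | hlt
      · rw [rEntry_eq_zero H hlt, zero_mul]
      · have : x j = 0 := by
          by_contra hne
          exact not_lt.2 (hmax j (by simpa using hne)) hlt
        rw [this, Int.cast_zero, mul_zero]
    · simp

/-- Minkowski on the block of `R` with indices in `[k, j]` gives a nonzero integer vector whose
forms are at most `s`, the geometric mean of the block's diagonal. Padded by zeros, it yields a
projected lattice vector of squared norm at most `card * s²`, which the shortest vector cannot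
exceed. -/
lemma IsBoostedKZ.log_sq_rEntry_le {H : Matrix (Fin m) (Fin n) ℝ} (h : IsBoostedKZ H)
    {k j : Fin n} (hkj : k ≤ j) :
    Real.log (rEntry H k k ^ 2) ≤ Real.log (Finset.Icc k j).card
      + (∑ i ∈ Finset.Icc k j, Real.log (rEntry H i i ^ 2)) / (Finset.Icc k j).card := by
  classical
  have hr := rEntry_self_pos h.basis
  let A : Matrix (Finset.Icc k j) (Finset.Icc k j) ℝ := (rMat H).submatrix (↑) (↑)
  have hdet : A.det = ∏ i ∈ Finset.Icc k j, rEntry H i i := by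
    rw [Matrix.det_of_isUpperTriangular (M := A) fun a b hab => rEntry_eq_zero H hab]
    exact Finset.prod_coe_sort (Finset.Icc k j) fun i => rEntry H i i
  have hP : 0 < ∏ i ∈ Finset.Icc k j, rEntry H i i := Finset.prod_pos fun i _ => hr i
  have hne : (Finset.Icc k j).Nonempty := ⟨k, Finset.mem_Icc.2 ⟨le_rfl, hkj⟩⟩
  have : Nonempty (Finset.Icc k j) := hne.coe_sort
  have hc : ((Finset.Icc k j).card : ℝ) ≠ 0 := by
    exact_mod_cast hne.card_pos.ne'
  set s : ℝ := (∏ i ∈ Finset.Icc k j, rEntry H i i) ^ (((Finset.Icc k j).card : ℝ)⁻¹) with hs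
  have hspos : 0 < s := Real.rpow_pos_of_pos hP _
  obtain ⟨x, hx0, hx⟩ := exists_int_abs_mulVec_le (A := A) (hdet ▸ hP.ne') hspos.le (by
    rw [hdet, abs_of_pos hP, Fintype.card_coe, ← Real.rpow_natCast, hs, ← Real.rpow_mul hP.le,
      inv_mul_cancel₀ hc, Real.rpow_one])
  let x' : Fin n → ℤ := fun l => if hl : l ∈ Finset.Icc k j then x ⟨l, hl⟩ else 0
  have hx' : ∀ l : Finset.Icc k j, x' l = x l := fun l => by
    simp only [x', dif_pos l.2]
  have hout : ∀ l, l ∉ Finset.Icc k j → x' l = 0 := fun l hl => dif_neg hl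
  have hform : ∀ i, ∑ l, rEntry H i l * (x' l : ℝ)
      = ∑ l : Finset.Icc k j, rEntry H i l * (x l : ℝ) := by
    intro i
    rw [← Finset.sum_subset (Finset.subset_univ (Finset.Icc k j))
      (fun l _ hl => by rw [hout l hl, Int.cast_zero, mul_zero]), ← Finset.sum_coe_sort]
    simp only [hx']
  have hle := h.sq_rEntry_le_sum (k := k) (x := x')
    (fun h0 => hx0 (funext fun l => by rw [← hx', h0]; rfl))
    (fun l hl => hout l fun hl' => not_lt.2 (Finset.mem_Icc.1 hl').1 hl)
  have hbound : rEntry H k k ^ 2 ≤ (Finset.Icc k j).card * s ^ 2 := by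
    refine hle.trans ?_
    rw [← Finset.sum_subset (s₁ := Finset.Icc k j)
      (fun i hi => Finset.mem_Ici.2 (Finset.mem_Icc.1 hi).1), ← nsmul_eq_mul]
    · refine Finset.sum_le_card_nsmul _ _ _ fun i hi => ?_
      rw [hform, ← sq_abs]
      exact pow_le_pow_left₀ (abs_nonneg _) (hx ⟨i, hi⟩) 2
    -- Rows below the block vanish on the padded vector because `R` is triangular.
    · intro i hi hi'
      rw [hform, Finset.sum_eq_zero, zero_pow two_ne_zero]
      intro l _
      have hji : j < i := not_le.1 fun hij =>
        hi' (Finset.mem_Icc.2 ⟨Finset.mem_Ici.1 hi, hij⟩)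
      rw [rEntry_eq_zero H ((Finset.mem_Icc.1 l.2).2.trans_lt hji), zero_mul]
  have hlog := Real.log_le_log (pow_pos (hr k) 2) hbound
  rw [Real.log_mul hc (pow_ne_zero 2 hspos.ne'), Real.log_pow s 2, hs, Real.log_rpow hP,
    Real.log_prod fun i _ => (hr i).ne'] at hlog
  refine hlog.trans_eq ?_
  simp only [Real.log_pow, ← Finset.mul_sum]
  field_simp

/-! ### Schnorr's recursion. -/

/-- Induction step for the running means. With `a`, `b` the two logarithms, the increment is `(a -
b)(2 + a + b)`, and `a - b ≥ 1/(t+2)` reduces the claim to `a ≤ (t+1)(2 + b)`. -/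
lemma log_add_two_le (t : ℕ) :
    Real.log (t + 2) ≤ (t + 1) * ((2 * Real.log (t + 2) + Real.log (t + 2) ^ 2)
      - (2 * Real.log (t + 1) + Real.log (t + 1) ^ 2)) := by
  have ht : (0 : ℝ) ≤ t := Nat.cast_nonneg t
  have h1 : 1 / (t + 2 : ℝ) ≤ Real.log (t + 2) - Real.log (t + 1) := by
    rw [← Real.log_div (by positivity) (by positivity)]
    refine le_trans (le_of_eq ?_) (Real.one_sub_inv_le_log_of_pos (by positivity))
    field_simp
    ring
  have h2 : Real.log (t + 2) ≤ t + 1 := by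
    have := Real.log_le_sub_one_of_pos (show (0 : ℝ) < t + 2 by positivity)
    linarith
  have h3 : 0 ≤ Real.log ((t : ℝ) + 1) := Real.log_nonneg (by linarith)
  have h4 : 0 ≤ Real.log ((t : ℝ) + 2) := Real.log_nonneg (by linarith)
  set a := Real.log ((t : ℝ) + 2)
  set b := Real.log ((t : ℝ) + 1)
  have h5 : a ≤ (t + 1) * (1 / (t + 2) * (2 + a + b)) := by
    rw [show ((t : ℝ) + 1) * (1 / (t + 2) * (2 + a + b)) = (t + 1) * (2 + a + b) / (t + 2) by ring,
      le_div_iff₀ (by positivity)]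
    nlinarith [mul_nonneg ht h3]
  calc a ≤ (t + 1) * (1 / (t + 2) * (2 + a + b)) := h5
    _ ≤ (t + 1) * ((a - b) * (2 + a + b)) := by gcongr
    _ = _ := by ring

/-- Schnorr's recursion: a sequence whose terms exceed their running means by at most `log` grows
at most like `log ^ 2`. -/
lemma le_of_le_log_add_mean {b : ℕ → ℝ} {N : ℕ}
    (hb : ∀ t ≤ N, b t ≤ Real.log (t + 1) + (∑ s ∈ Finset.range (t + 1), b s) / (t + 1)) :
    ∀ t ≤ N, b t ≤ b 0 + (3 * Real.log (t + 1) + Real.log (t + 1) ^ 2) := by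
  -- The means grow like `2 log + log²`; passing from mean to term adds the third `log`.
  have hmean : ∀ t ≤ N, (∑ s ∈ Finset.range (t + 1), b s)
      ≤ (t + 1) * (b 0 + (2 * Real.log (t + 1) + Real.log (t + 1) ^ 2)) := by
    intro t
    induction t with
    | zero => simp
    | succ t ih =>
      intro ht
      have h1 := ih (by omega)
      have h2 := hb (t + 1) ht
      have h3 := log_add_two_le t
      rw [Finset.sum_range_succ] at h2 ⊢
      push_cast at h2 ⊢
      rw [add_assoc, one_add_one_eq_two] at h2 ⊢
      set S := ∑ s ∈ Finset.range (t + 1), b s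
      set c := b (t + 1)
      set u := Real.log ((t : ℝ) + 2)
      set w := Real.log ((t : ℝ) + 1)
      have ht2 : (0 : ℝ) < t + 2 := by positivity
      have ht1 : (0 : ℝ) < t + 1 := by positivity
      have h4 : c * (t + 2) ≤ u * (t + 2) + (S + c) := by
        have := mul_le_mul_of_nonneg_right h2 ht2.le
        rwa [add_mul, div_mul_cancel₀ _ ht2.ne'] at this
      refine le_of_mul_le_mul_left ?_ ht1
      calc (t + 1) * (S + c) ≤ (t + 2) * (S + u) := by linarith
        _ ≤ (t + 2) * ((t + 1) * (b 0 + (2 * w + w ^ 2))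
              + (t + 1) * ((2 * u + u ^ 2) - (2 * w + w ^ 2))) := by gcongr
        _ = _ := by ring
  intro t ht
  have h1 := hb t ht
  have h2 := hmean t ht
  have ht1 : (0 : ℝ) < t + 1 := by positivity
  rw [mul_comm, ← div_le_iff₀ ht1] at h2
  linarith

lemma IsBoostedKZ.sq_rEntry_le {H : Matrix (Fin m) (Fin n) ℝ} (h : IsBoostedKZ H)
    {k j : Fin n} (hkj : k ≤ j) :
    rEntry H k k ^ 2 ≤ rEntry H j j ^ 2
      * Real.exp (3 * Real.log ((j : ℕ) + 1) + Real.log ((j : ℕ) + 1) ^ 2) := by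
  have hr := rEntry_self_pos h.basis
  -- The diagonal is read backwards from `j`, so that the block `[j - t, j]` becomes an initial
  -- segment.
  let b : ℕ → ℝ := fun s => Real.log (rEntry H ⟨j - s, by omega⟩ ⟨j - s, by omega⟩ ^ 2)
  have hb : ∀ t ≤ (j : ℕ),
      b t ≤ Real.log (t + 1) + (∑ s ∈ Finset.range (t + 1), b s) / (t + 1) := by
    intro t ht
    have h1 := h.log_sq_rEntry_le (k := ⟨j - t, by omega⟩) (j := j)
      (by rw [Fin.le_def]; simp)
    have hcard : (Finset.Icc (⟨j - t, by omega⟩ : Fin n) j).card = t + 1 := by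
      rw [Fin.card_Icc]
      simp only
      omega
    have hsum : ∑ i ∈ Finset.Icc (⟨j - t, by omega⟩ : Fin n) j, Real.log (rEntry H i i ^ 2)
        = ∑ s ∈ Finset.range (t + 1), b s := by
      refine Finset.sum_nbij' (fun i => (j : ℕ) - i) (fun s => ⟨j - s, by omega⟩) ?_ ?_ ?_ ?_ ?_
      · intro i hi
        simp only [Finset.mem_Icc, Fin.le_def, Finset.mem_range] at hi ⊢
        omega
      · intro s hs
        simp only [Finset.mem_Icc, Fin.le_def, Finset.mem_range] at hs ⊢
        omega
      · intro i hi
        simp only [Finset.mem_Icc, Fin.le_def] at hi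
        ext
        simp only
        omega
      · intro s hs
        simp only [Finset.mem_range] at hs ⊢
        omega
      · intro i hi
        simp only [Finset.mem_Icc, Fin.le_def] at hi
        have : (⟨j - (j - i), by omega⟩ : Fin n) = i := by
          ext
          simp only
          omega
        simp only [b, this]
    rw [hcard, hsum] at h1
    exact_mod_cast h1
  have hkj' : (k : ℕ) ≤ j := hkj
  have h2 := le_of_le_log_add_mean hb (j - k) (by omega)
  have hk : b (j - k) = Real.log (rEntry H k k ^ 2) := by
    have : (⟨j - (j - k), by omega⟩ : Fin n) = k := by
      ext
      simp only
      omega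
    simp only [b, this]
  have h0 : b 0 = Real.log (rEntry H j j ^ 2) := rfl
  have hcast : (((j - k : ℕ) : ℝ) + 1) ≤ (j : ℕ) + 1 := by
    gcongr
    omega
  have hlog : Real.log (((j - k : ℕ) : ℝ) + 1) ≤ Real.log ((j : ℕ) + 1) :=
    Real.log_le_log (by positivity) hcast
  have hlog0 : 0 ≤ Real.log (((j - k : ℕ) : ℝ) + 1) :=
    Real.log_nonneg (by simp)
  rw [← Real.log_le_log_iff (pow_pos (hr k) 2) (mul_pos (pow_pos (hr j) 2) (Real.exp_pos _)),
    Real.log_mul (pow_pos (hr j) 2).ne' (Real.exp_pos _).ne', Real.log_exp, ← hk, ← h0]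
  refine h2.trans ?_
  gcongr

/-! ### Column lengths of b-KZ bases. -/

lemma IsBoostedKZ.norm_sq_colVec_le {H : Matrix (Fin m) (Fin n) ℝ} (h : IsBoostedKZ H)
    (i : Fin n) :
    ‖colVec H i‖ ^ 2 ≤ rEntry H i i ^ 2 + 1 / 4 * ∑ j ∈ Finset.Iio i, rEntry H j j ^ 2 := by
  rcases Nat.eq_zero_or_pos (i : ℕ) with hi | hi
  · rw [norm_colVec_zero h.basis hi]
    have : 0 ≤ ∑ j ∈ Finset.Iio i, rEntry H j j ^ 2 := by positivity
    linarith
  · obtain ⟨q, ⟨hq, hmin⟩, hle⟩ := h.length i hi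
    obtain ⟨z, hz⟩ := exists_isNearestPlane H i
    have hzmem : latticePoint H z ∈ prefixLattice H i := by
      rw [latticePoint_eq_sum]
      refine Submodule.sum_mem _ fun l _ => ?_
      by_cases hl : l < i
      · rw [Int.cast_smul_eq_zsmul]
        exact Submodule.smul_mem _ _ (Submodule.subset_span ⟨l, hl, rfl⟩)
      · rw [hz.1 l (not_lt.1 hl)]
        simp
    have hspan : ∀ u ∈ prefixLattice H i, u ∈ prefixSpan H i := fun u hu =>
      Submodule.span_subset_span ℤ ℝ _ hu
    -- By Pythagoras, distances to `h_i` and to its projection rank prefix lattice points alike;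
    -- hence `q` does at least as well as a nearest plane point.
    have hpyth : ∀ u ∈ prefixLattice H i, ‖colVec H i - u‖ ^ 2
        = ‖colVec H i - proj H i (colVec H i)‖ ^ 2 + ‖proj H i (colVec H i) - u‖ ^ 2 := by
      intro u hu
      have h0 : inner ℝ (colVec H i - proj H i (colVec H i)) (proj H i (colVec H i) - u) = 0 :=
        Submodule.inner_left_of_mem_orthogonal
          (Submodule.sub_mem _ (Submodule.starProjection_apply_mem _ _) (hspan u hu))
          (Submodule.sub_starProjection_mem_orthogonal _)
      have := norm_add_sq_eq_norm_sq_add_norm_sq_real h0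
      rw [sub_add_sub_cancel] at this
      simpa only [sq] using this
    calc ‖colVec H i‖ ^ 2 ≤ ‖colVec H i - q‖ ^ 2 := pow_le_pow_left₀ (norm_nonneg _) hle 2
      _ ≤ ‖colVec H i - latticePoint H z‖ ^ 2 := by
          rw [hpyth q hq, hpyth _ hzmem]
          gcongr
          exact hmin _ hzmem
      _ ≤ _ := norm_sq_sub_nearestPlane_le h.basis hz

lemma IsBoostedKZ.norm_colVec_le {H : Matrix (Fin m) (Fin n) ℝ} (h : IsBoostedKZ H)
    (i : Fin n) :
    ‖colVec H i‖ ≤ ((i + 1 : ℕ) : ℝ) ^ (2 + Real.log ((i + 1 : ℕ) : ℝ) / 2) * rEntry H i i := by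
  have hr := rEntry_self_pos h.basis i
  refine le_of_sq_le_sq ?_ (mul_nonneg (by positivity) hr.le)
  push_cast
  have hM : (0 : ℝ) < (i : ℕ) + 1 := by positivity
  set E := Real.exp (3 * Real.log ((i : ℕ) + 1) + Real.log ((i : ℕ) + 1) ^ 2) with hE
  have hL : 0 ≤ Real.log ((i : ℕ) + 1 : ℝ) := Real.log_nonneg (by simp)
  have hE1 : 1 ≤ E := Real.one_le_exp (by positivity)
  have hsum : ∑ j ∈ Finset.Iio i, rEntry H j j ^ 2 ≤ (i : ℕ) * (rEntry H i i ^ 2 * E) := by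
    refine (Finset.sum_le_card_nsmul _ _ _ fun j hj =>
      h.sq_rEntry_le (Finset.mem_Iio.1 hj).le).trans_eq ?_
    rw [Fin.card_Iio, nsmul_eq_mul]
  -- With `M = i + 1`, `E = M^(3 + log M)`. There are at most `M` terms, each at most `R_ii² E`,
  -- which gives `M^(4 + log M)`, the square of the claimed factor.
  have hpow : (((i : ℕ) + 1 : ℝ) ^ (2 + Real.log ((i : ℕ) + 1) / 2)) ^ 2
      = ((i : ℕ) + 1) * E := by
    rw [hE, Real.rpow_def_of_pos hM, ← Real.exp_nat_mul]
    nth_rewrite 3 [← Real.exp_log hM]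
    rw [← Real.exp_add]
    congr 1
    push_cast
    ring
  rw [mul_pow, hpow]
  calc ‖colVec H i‖ ^ 2 ≤ rEntry H i i ^ 2 + 1 / 4 * ∑ j ∈ Finset.Iio i, rEntry H j j ^ 2 :=
        h.norm_sq_colVec_le i
    _ ≤ rEntry H i i ^ 2 * E + (i : ℕ) * (rEntry H i i ^ 2 * E) := by
        have h1 : rEntry H i i ^ 2 ≤ rEntry H i i ^ 2 * E :=
          le_mul_of_one_le_right (sq_nonneg _) hE1
        have h2 : 0 ≤ ∑ j ∈ Finset.Iio i, rEntry H j j ^ 2 :=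
          Finset.sum_nonneg fun j _ => sq_nonneg _
        linarith
    _ = _ := by ring

end LatticePrecoding

end

theorem theorem2 {m n : ℕ} (hn : 1 ≤ n) (H : Matrix (Fin m) (Fin n) ℝ) :
    (∀ (δ β : ℝ) (p : ℕ), 1 / 4 < δ → δ < 1 → β = 1 / Real.sqrt (δ - 1 / 4) →
      LatticePrecoding.IsBoostedLLL δ p H →
      ∃ η : ℝ, LatticePrecoding.IsEnergyEfficiency H (LatticePrecoding.zf H) η ∧
        η ≤ 2 * (n : ℝ) * (∏ j ∈ Finset.Icc 1 n, β ^ (j - 1)) + 1) ∧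
    (LatticePrecoding.IsBoostedKZ H →
      ∃ η : ℝ, LatticePrecoding.IsEnergyEfficiency H (LatticePrecoding.zf H) η ∧
        η ≤ 2 * (n : ℝ) * (∏ j ∈ Finset.Icc 1 n, (j : ℝ) ^ (2 + Real.log (j : ℝ) / 2)) + 1) :=
  ⟨fun _ β _ hδ hδ1 hβ h =>
    LatticePrecoding.exists_zf_isEnergyEfficiency_le hn h.basis (f := fun j => β ^ (j - 1))
      fun i => h.norm_colVec_le hδ hδ1 hβ i,
    fun h => LatticePrecoding.exists_zf_isEnergyEfficiency_le hn h.basis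
      (f := fun j => (j : ℝ) ^ (2 + Real.log (j : ℝ) / 2)) h.norm_colVec_le⟩
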